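/- Let $\mathcal B=\mathbf C\langle e_1,\dots,e_N\rangle$ be the free unital algebra and let $q_{ij}\in\mathbf C\setminus\{0\}$, $1\le i,j\le N$. Let $\partial_1,\dots,\partial_N$ be the linear operators on $\mathcal B$ determined by $\partial_i 1=0$ and $\partial_i(e_jx)=\delta_{ij}\,x+q_{ij}\,e_j\,\partial_i x$ for all $x\in\mathcal B$. A constant is an element of $\mathcal B$ without term of degree $0$ that is annihilated by all $\partial_i$. For a finite multiset $Q$ of indices let $\mathcal B_Q$ be the span of the monomials $e_{i_1}\cdots e_{i_n}$ with $i_1\dots i_n$ a permutation of $Q$. Define iterated $q$-commutators by $X^{i_1}=e_{i_1}$ and $$X^{i_1\dots i_p}=X^{i_1\dots i_{p-1}}e_{i_p}-q_{i_pi_1}\cdots q_{i_pi_{p-1}}\;e_{i_p}X^{i_1\dots i_{p-1}},$$ and for $j\in Q$ let $\hat X^j$ be the set of all $X^{j\,i_2\dots i_n}$ with $j\,i_2\dots i_n$ a permutation of $Q$. Fix $Q$, and for $j\in Q$ let $Q_j$ be obtained from $Q$ by removing one copy of $j$. Assume that for every $j\in Q$ there is no nonzero constant in $\mathcal B_{Q_j}$;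 if $Q$ consists of copies of a single index, assume moreover that there is no nonzero constant in $\mathcal B_{Q'}$ for any proper sub-multiset $Q'$ of $Q$. Then for every $j\in Q$ the span $\mathbf C\hat X^j$ contains all constants in $\mathcal B_Q$. Hence for all $i\ne j$ in $Q$ the space of constants in $\mathcal B_Q$ equals $\mathbf C\hat X^i\cap\mathbf C\hat X^j$. -/

import Mathlib

open scoped BigOperators

namespace QAlg

noncomputable section

/-- The monomial `e_{i_1} ... e_{i_n}` of the free algebra attached to a word. -/
def mon {N : ℕ} (w : List (Fin N)) : FreeAlgebra ℂ (Fin N) :=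
  (w.map (FreeAlgebra.ι ℂ)).prod

/-- The value of the `q`-differential operator `∂_i` on a monomial, by the recursion
`∂_i 1 = 0`, `∂_i (e_j x) = δ_{ij} x + q_{ij} e_j (∂_i x)`. -/
def dWord {N : ℕ} (q : Fin N → Fin N → ℂ) (i : Fin N) :
    List (Fin N) → FreeAlgebra ℂ (Fin N)
  | [] => 0
  | j :: w => (if i = j then mon w else 0) + q i j • (FreeAlgebra.ι ℂ j * dWord q i w)

/-- The `q`-differential operator `∂_i` on the free algebra (linear extension of `dWord`);
see `qd_one` and `qd_ι_mul` for its defining properties. -/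
def qd {N : ℕ} (q : Fin N → Fin N → ℂ) (i : Fin N) :
    FreeAlgebra ℂ (Fin N) →ₗ[ℂ] FreeAlgebra ℂ (Fin N) :=
  (FreeAlgebra.basisFreeMonoid ℂ (Fin N)).constr ℂ (fun w => dWord q i w.toList)

/-- The homogeneous component `B_Q`: the span of the monomials whose letters, counted with
multiplicity, form the multiset `Q`. -/
def homog {N : ℕ} (Q : Multiset (Fin N)) : Submodule ℂ (FreeAlgebra ℂ (Fin N)) :=
  Submodule.span ℂ {x | ∃ w : List (Fin N), (w : Multiset (Fin N)) = Q ∧ x = mon w}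

/-- The constants: elements without term of degree `0` that are annihilated by every `∂_i`. -/
def constants {N : ℕ} (q : Fin N → Fin N → ℂ) : Submodule ℂ (FreeAlgebra ℂ (Fin N)) :=
  LinearMap.ker (FreeAlgebra.algebraMapInv (R := ℂ) (X := Fin N)).toLinearMap ⊓
    ⨅ i : Fin N, LinearMap.ker (qd q i)

/-- The space of constants in `B_Q`. -/
def constantsIn {N : ℕ} (q : Fin N → Fin N → ℂ) (Q : Multiset (Fin N)) :
    Submodule ℂ (FreeAlgebra ℂ (Fin N)) :=
  homog Q ⊓ constants q

/-- The `q`-commutator `[x, y]_a = x y - a y x`. -/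
def qComm {N : ℕ} (a : ℂ) (x y : FreeAlgebra ℂ (Fin N)) : FreeAlgebra ℂ (Fin N) :=
  x * y - a • (y * x)

/-- The commutation factor `a(i_1 ... i_p i) = q_{i i_1} ... q_{i i_p}`. -/
def commFactor {N : ℕ} (q : Fin N → Fin N → ℂ) (w : List (Fin N)) (i : Fin N) : ℂ :=
  (w.map (fun l => q i l)).prod

/-- Auxiliary recursion for `iterComm`, reading the word from its last letter backwards. -/
def iterCommRev {N : ℕ} (q : Fin N → Fin N → ℂ) : List (Fin N) → FreeAlgebra ℂ (Fin N)
  | [] => 1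
  | [i] => FreeAlgebra.ι ℂ i
  | i :: l :: w =>
      qComm (commFactor q (l :: w) i) (iterCommRev q (l :: w)) (FreeAlgebra.ι ℂ i)

/-- The iterated `q`-commutator `X^{i_1 ... i_n}`: `X^{i_1} = e_{i_1}` and
`X^{i_1 ... i_p} = [X^{i_1 ... i_{p-1}}, e_{i_p}]_a` with `a = q_{i_p i_1} ... q_{i_p i_{p-1}}`;
see `iterComm_singleton` and `iterComm_append`. -/
def iterComm {N : ℕ} (q : Fin N → Fin N → ℂ) (w : List (Fin N)) : FreeAlgebra ℂ (Fin N) :=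
  iterCommRev q w.reverse

/-- The set of all `X^{j i_2 ... i_n}` with `j i_2 ... i_n` a permutation of `Q`. -/
def hatX {N : ℕ} (q : Fin N → Fin N → ℂ) (Q : Multiset (Fin N)) (j : Fin N) :
    Set (FreeAlgebra ℂ (Fin N)) :=
  {x | ∃ w : List (Fin N), ((j :: w : List (Fin N)) : Multiset (Fin N)) = Q ∧
    x = iterComm q (j :: w)}

theorem basis_apply {N : ℕ} (w : FreeMonoid (Fin N)) :
    FreeAlgebra.basisFreeMonoid ℂ (Fin N) w = mon w.toList := by
  simp [FreeAlgebra.basisFreeMonoid, mon, FreeAlgebra.equivMonoidAlgebraFreeMonoid,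
    FreeMonoid.lift_apply]

theorem qd_mon {N : ℕ} (q : Fin N → Fin N → ℂ) (i : Fin N) (w : List (Fin N)) :
    qd q i (mon w) = dWord q i w := by
  have h := (FreeAlgebra.basisFreeMonoid ℂ (Fin N)).constr_basis ℂ
    (fun w => dWord q i w.toList) (FreeMonoid.ofList w)
  rw [basis_apply] at h
  exact h

theorem qd_one {N : ℕ} (q : Fin N → Fin N → ℂ) (i : Fin N) : qd q i 1 = 0 := by
  have h := qd_mon q i []
  simpa [mon, dWord] using h

theorem qd_ι_mul {N : ℕ} (q : Fin N → Fin N → ℂ) (i j : Fin N) (x : FreeAlgebra ℂ (Fin N)) :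
    qd q i (FreeAlgebra.ι ℂ j * x) =
      (if i = j then x else 0) + q i j • (FreeAlgebra.ι ℂ j * qd q i x) := by
  have hx : x ∈ Submodule.span ℂ (Set.range (FreeAlgebra.basisFreeMonoid ℂ (Fin N))) := by
    rw [Module.Basis.span_eq]; trivial
  induction hx using Submodule.span_induction with
  | zero => simp
  | add x y _ _ hx hy =>
    rw [mul_add, map_add, hx, hy, map_add]; split_ifs <;> simp [mul_add]; all_goals abel
  | smul c x _ hx => rw [mul_smul_comm, map_smul, hx, map_smul]; split_ifs <;> simp [smul_comm c]
  | mem x hx =>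
    obtain ⟨w, rfl⟩ := hx
    rw [basis_apply, qd_mon]
    have h := qd_mon q i (j :: w.toList)
    simpa [mon, dWord] using h

theorem iterComm_singleton {N : ℕ} (q : Fin N → Fin N → ℂ) (i : Fin N) :
    iterComm q [i] = FreeAlgebra.ι ℂ i := by
  simp [iterComm, iterCommRev]

theorem iterComm_append {N : ℕ} (q : Fin N → Fin N → ℂ) (w : List (Fin N)) (hw : w ≠ [])
    (i : Fin N) :
    iterComm q (w ++ [i]) =
      qComm (commFactor q w i) (iterComm q w) (FreeAlgebra.ι ℂ i) := by
  have hp : commFactor q w.reverse i = commFactor q w i := by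
    simp [commFactor, List.map_reverse, List.prod_reverse]
  rcases h : w.reverse with _ | ⟨l, v⟩
  · simp at h; exact absurd h hw
  · rw [h] at hp
    simp [iterComm, h, iterCommRev, hp]

end

end QAlg

namespace QAlg

noncomputable section

open TensorProduct FreeAlgebra

variable {N : ℕ}

/-! The argument is a braided form of the Dynkin–Specht–Wever lemma. Let `cop` be the coproduct on
the free algebra, with values in the braided tensor square, for which the generators are primitive,
and let `dynkin q j` send `e_j e_{i_2} ⋯ e_{i_n}` to `X^{j i_2 … i_n}` and every other monomial to
`0`. Convolving the identity with `dynkin q j` multiplies `B_Q` by the multiplicity of `j` in `Q`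
(`mulTensor_dynkin_cop`).

Since `∂_i ⊗ id` intertwines `cop` with `∂_i` (`rTensor_qd_cop`), the left tensor coefficients of
`cop x` are killed by all `∂_i` when `x` is a constant. If no smaller degree has a nonzero constant,
only the parts `1 ⊗ B_Q` and `B_Q ⊗ 1` survive; the second is lost because `dynkin q j` kills `1`.
Hence a nonzero multiple of `x` lies in the span of `hatX q Q j` (`constantsIn_le_span_hatX`).

Absence of constants in all smaller degrees follows from absence one letter below `Q`: the
`q`-commutator of a constant with a generator is again a constant, and is rarely zero
(`constantsIn_eq_bot_of_lt`). For the equality, every `∂_i` with `i ≠ j` kills `X^{j …}`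
(`qd_iterComm`), so all `∂_k` vanish on the intersection of two spans. -/

theorem mon_nil : mon ([] : List (Fin N)) = 1 := by simp [mon]

theorem mon_cons (i : Fin N) (w : List (Fin N)) : mon (i :: w) = ι ℂ i * mon w := by simp [mon]

theorem mon_append (v w : List (Fin N)) : mon (v ++ w) = mon v * mon w := by simp [mon]

theorem mon_concat (w : List (Fin N)) (i : Fin N) : mon (w ++ [i]) = mon w * ι ℂ i := by
  simp [mon]

theorem basis_ofList (w : List (Fin N)) :
    basisFreeMonoid ℂ (Fin N) (FreeMonoid.ofList w) = mon w := by
  rw [basis_apply]; rfl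

/-- Linear maps on the free algebra that agree on monomials are equal. -/
theorem linearMap_ext {M : Type*} [AddCommMonoid M] [Module ℂ M]
    {g h : FreeAlgebra ℂ (Fin N) →ₗ[ℂ] M} (H : ∀ w, g (mon w) = h (mon w)) : g = h :=
  (basisFreeMonoid ℂ (Fin N)).ext fun w => by rw [basis_apply]; exact H _

/-- The linear map with prescribed values on monomials. -/
def linearOfMon {M : Type*} [AddCommMonoid M] [Module ℂ M] (g : List (Fin N) → M) :
    FreeAlgebra ℂ (Fin N) →ₗ[ℂ] M :=
  (basisFreeMonoid ℂ (Fin N)).constr ℂ fun w => g w.toList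

theorem linearOfMon_mon {M : Type*} [AddCommMonoid M] [Module ℂ M] (g : List (Fin N) → M)
    (w : List (Fin N)) : linearOfMon g (mon w) = g w := by
  rw [← basis_ofList, linearOfMon, Module.Basis.constr_basis]; rfl

/-! ### Coordinates -/

/-- The coefficient of the monomial `mon u`. -/
def coeffAt (u : List (Fin N)) : FreeAlgebra ℂ (Fin N) →ₗ[ℂ] ℂ :=
  linearOfMon fun w => if w = u then 1 else 0

theorem coeffAt_mon (u w : List (Fin N)) : coeffAt u (mon w) = if w = u then 1 else 0 :=
  linearOfMon_mon _ _

theorem coeffAt_concat_mul_ι (u : List (Fin N)) (k : Fin N) (x : FreeAlgebra ℂ (Fin N)) :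
    coeffAt (u ++ [k]) (x * ι ℂ k) = coeffAt u x := by
  have : coeffAt (u ++ [k]) ∘ₗ LinearMap.mulRight ℂ (ι ℂ k) = coeffAt u :=
    linearMap_ext fun w => by simp [← mon_concat, coeffAt_mon]
  exact LinearMap.congr_fun this x

theorem coeffAt_cons_ι_mul (u : List (Fin N)) (l k : Fin N) (x : FreeAlgebra ℂ (Fin N)) :
    coeffAt (l :: u) (ι ℂ k * x) = if k = l then coeffAt u x else 0 := by
  have : coeffAt (l :: u) ∘ₗ LinearMap.mulLeft ℂ (ι ℂ k) =
      (if k = l then coeffAt u else 0) :=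
    linearMap_ext fun w => by
      split_ifs with h <;> simp [← mon_cons, coeffAt_mon, h]
  have := LinearMap.congr_fun this x
  split_ifs with h <;> simpa [h] using this

theorem eq_zero_of_coeffAt {x : FreeAlgebra ℂ (Fin N)} (h : ∀ u, coeffAt u x = 0) : x = 0 := by
  have key : ∀ u : FreeMonoid (Fin N), (basisFreeMonoid ℂ (Fin N)).coord u = coeffAt u.toList := by
    intro u
    refine (basisFreeMonoid ℂ (Fin N)).ext fun w => ?_
    rw [Module.Basis.coord_apply, Module.Basis.repr_self, basis_apply, coeffAt_mon]
    rcases eq_or_ne w u with rfl | h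
    · simp
    · have h' : w.toList ≠ u.toList := fun e => h e
      rw [Finsupp.single_eq_of_ne' h, if_neg h']
  refine (basisFreeMonoid ℂ (Fin N)).ext_elem fun u => ?_
  have := LinearMap.congr_fun (key u) x
  rw [h] at this
  simpa using this

/-! ### Homogeneous components -/

theorem mon_mem_homog (w : List (Fin N)) : mon w ∈ homog (w : Multiset (Fin N)) :=
  Submodule.subset_span ⟨w, rfl, rfl⟩

theorem coeffAt_eq_zero_of_mem_homog {Q : Multiset (Fin N)} {x : FreeAlgebra ℂ (Fin N)}
    (hx : x ∈ homog Q) {u : List (Fin N)} (hu : (u : Multiset (Fin N)) ≠ Q) :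
    coeffAt u x = 0 := by
  have : homog Q ≤ LinearMap.ker (coeffAt u) := by
    refine Submodule.span_le.2 ?_
    rintro _ ⟨w, hw, rfl⟩
    have : w ≠ u := by rintro rfl; exact hu hw
    simp [coeffAt_mon, this]
  exact this hx

theorem mul_mem_homog {P Q : Multiset (Fin N)} {x y : FreeAlgebra ℂ (Fin N)}
    (hx : x ∈ homog P) (hy : y ∈ homog Q) : x * y ∈ homog (P + Q) := by
  have h := Submodule.mul_mem_mul hx hy
  rw [homog, homog, Submodule.span_mul_span] at h
  refine Submodule.span_mono ?_ h
  rintro _ ⟨_, ⟨v, hv, rfl⟩, _, ⟨w, hw, rfl⟩, rfl⟩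
  exact ⟨v ++ w, by rw [← hv, ← hw, Multiset.coe_add], (mon_append v w).symm⟩

theorem ι_mem_homog (i : Fin N) : ι ℂ i ∈ homog ({i} : Multiset (Fin N)) := by
  simpa [mon] using mon_mem_homog [i]

theorem mem_homog_zero {x : FreeAlgebra ℂ (Fin N)} (hx : x ∈ homog (0 : Multiset (Fin N))) :
    ∃ c : ℂ, x = c • 1 := by
  have : homog (0 : Multiset (Fin N)) ≤ Submodule.span ℂ {1} := by
    refine Submodule.span_mono ?_
    rintro _ ⟨w, hw, rfl⟩
    simp only [Multiset.coe_eq_zero] at hw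
    subst hw
    exact mon_nil
  obtain ⟨c, hc⟩ := Submodule.mem_span_singleton.1 (this hx)
  exact ⟨c, hc.symm⟩

theorem algebraMapInv_mon (w : List (Fin N)) :
    algebraMapInv (R := ℂ) (mon w) = if w = [] then 1 else 0 := by
  cases w with
  | nil => simp [mon_nil]
  | cons i w => simp [mon_cons, algebraMapInv]

theorem algebraMapInv_of_mem_homog {Q : Multiset (Fin N)} (hQ : Q ≠ 0)
    {x : FreeAlgebra ℂ (Fin N)} (hx : x ∈ homog Q) : algebraMapInv (R := ℂ) x = 0 := by
  have : homog Q ≤ LinearMap.ker (algebraMapInv (R := ℂ) (X := Fin N)).toLinearMap := by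
    refine Submodule.span_le.2 ?_
    rintro _ ⟨w, hw, rfl⟩
    have : w ≠ [] := by rintro rfl; exact hQ hw.symm
    simp [algebraMapInv_mon, this]
  exact this hx

/-- In nonzero degree the condition on the degree `0` term is automatic. -/
theorem mem_constantsIn_iff {q : Fin N → Fin N → ℂ} {Q : Multiset (Fin N)} (hQ : Q ≠ 0)
    {x : FreeAlgebra ℂ (Fin N)} :
    x ∈ constantsIn q Q ↔ x ∈ homog Q ∧ ∀ i, qd q i x = 0 := by
  simp only [constantsIn, constants, Submodule.mem_inf, Submodule.mem_iInf, LinearMap.mem_ker]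
  exact ⟨fun h => ⟨h.1, h.2.2⟩, fun h => ⟨h.1, algebraMapInv_of_mem_homog hQ h.1, h.2⟩⟩

theorem constantsIn_zero (q : Fin N → Fin N → ℂ) : constantsIn q 0 = ⊥ := by
  refine (Submodule.eq_bot_iff _).2 fun x hx => ?_
  obtain ⟨c, rfl⟩ := mem_homog_zero hx.1
  have : algebraMapInv (R := ℂ) (c • (1 : FreeAlgebra ℂ (Fin N))) = 0 := hx.2.1
  have hc : c = 0 := by simpa using this
  simp [hc]

/-! ### The diagonal automorphisms -/

/-- The algebra endomorphism `e_l ↦ q_{il} e_l`. -/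
def scale (q : Fin N → Fin N → ℂ) (i : Fin N) :
    FreeAlgebra ℂ (Fin N) →ₐ[ℂ] FreeAlgebra ℂ (Fin N) :=
  FreeAlgebra.lift ℂ fun l => q i l • ι ℂ l

theorem scale_ι (q : Fin N → Fin N → ℂ) (i l : Fin N) : scale q i (ι ℂ l) = q i l • ι ℂ l := by
  simp [scale]

theorem scale_mon (q : Fin N → Fin N → ℂ) (i : Fin N) (w : List (Fin N)) :
    scale q i (mon w) = commFactor q w i • mon w := by
  induction w with
  | nil => simp [mon_nil, commFactor]
  | cons l w ih =>
    rw [mon_cons, map_mul, ih, scale_ι, smul_mul_smul_comm]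
    simp [commFactor]

theorem scale_of_mem_homog (q : Fin N → Fin N → ℂ) (i : Fin N) {w : List (Fin N)}
    {x : FreeAlgebra ℂ (Fin N)} (hx : x ∈ homog (w : Multiset (Fin N))) :
    scale q i x = commFactor q w i • x := by
  have : homog (w : Multiset (Fin N)) ≤
      LinearMap.eqLocus (scale q i).toLinearMap (commFactor q w i • LinearMap.id) := by
    refine Submodule.span_le.2 ?_
    rintro _ ⟨v, hv, rfl⟩
    have : commFactor q v i = commFactor q w i :=
      ((Multiset.coe_eq_coe.1 hv).map _).prod_eq
    simp [scale_mon, this]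
  exact this hx

/-- The Leibniz rule defining `∂_i` peels letters off on the left; iterated commutators and the
coproduct grow on the right, so this mirrored rule is the one used later. -/
theorem qd_mul_ι (q : Fin N → Fin N → ℂ) (i k : Fin N) (x : FreeAlgebra ℂ (Fin N)) :
    qd q i (x * ι ℂ k) = qd q i x * ι ℂ k + if i = k then scale q i x else 0 := by
  have : qd q i ∘ₗ LinearMap.mulRight ℂ (ι ℂ k) =
      LinearMap.mulRight ℂ (ι ℂ k) ∘ₗ qd q i +
        if i = k then (scale q i).toLinearMap else 0 := by
    refine linearMap_ext fun w => ?_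
    induction w with
    | nil =>
      have := qd_ι_mul q i k 1
      rw [mul_one] at this
      split_ifs at this ⊢ with h <;> simpa [mon_nil, qd_one, h] using this
    | cons l w ih =>
      have e : mon (l :: w) * ι ℂ k = ι ℂ l * (mon w * ι ℂ k) := by rw [mon_cons, mul_assoc]
      split_ifs at ih ⊢ with h <;>
      · simp only [LinearMap.comp_apply, LinearMap.mulRight_apply, LinearMap.add_apply,
          LinearMap.zero_apply, AlgHom.toLinearMap_apply] at ih ⊢
        rw [e, qd_ι_mul, ih, mon_cons, qd_ι_mul]
        split_ifs <;>
          simp [mul_add, add_mul, mul_assoc, scale_ι, add_assoc]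
  have := LinearMap.congr_fun this x
  split_ifs at this ⊢ <;> simpa using this

/-! ### Iterated commutators -/

theorem iterComm_mem_homog (q : Fin N → Fin N → ℂ) (w : List (Fin N)) :
    iterComm q w ∈ homog (w : Multiset (Fin N)) := by
  induction w using List.reverseRecOn with
  | nil => simpa [mon_nil, iterComm, iterCommRev] using mon_mem_homog ([] : List (Fin N))
  | append_singleton w i ih =>
    rcases eq_or_ne w [] with rfl | hw
    · rw [List.nil_append, iterComm_singleton]
      exact ι_mem_homog i
    · rw [iterComm_append q w hw, qComm, ← Multiset.coe_add]
      refine Submodule.sub_mem _ (mul_mem_homog ih (ι_mem_homog i)) (Submodule.smul_mem _ _ ?_)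
      rw [add_comm]
      exact mul_mem_homog (ι_mem_homog i) ih

/-- Commuting with a generator preserves the kernel of a `q`-derivation. -/
theorem qd_qComm_eq_zero {q : Fin N → Fin N → ℂ} {i : Fin N} {w : List (Fin N)}
    {x : FreeAlgebra ℂ (Fin N)} (hx : x ∈ homog (w : Multiset (Fin N))) (h : qd q i x = 0)
    (k : Fin N) : qd q i (qComm (commFactor q w k) x (ι ℂ k)) = 0 := by
  rw [qComm, map_sub, map_smul, qd_mul_ι, qd_ι_mul, h]
  -- If `i = k`, what remains is `scale q k x` minus `commFactor q w k • x`: the commutation factor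
  -- is chosen to make these cancel.
  split_ifs with hik
  · subst hik
    simp [scale_of_mem_homog q i hx]
  · simp

theorem qd_iterComm {q : Fin N → Fin N → ℂ} {i j : Fin N} (hij : i ≠ j) (w : List (Fin N)) :
    qd q i (iterComm q (j :: w)) = 0 := by
  induction w using List.reverseRecOn with
  | nil =>
    have := qd_ι_mul q i j 1
    rw [iterComm_singleton]
    simpa [qd_one, hij] using this
  | append_singleton w k ih =>
    rw [← List.cons_append, iterComm_append q _ (List.cons_ne_nil _ _)]
    exact qd_qComm_eq_zero (iterComm_mem_homog q _) ih k

theorem span_hatX_le_homog (q : Fin N → Fin N → ℂ) (Q : Multiset (Fin N)) (j : Fin N) :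
    Submodule.span ℂ (hatX q Q j) ≤ homog Q := by
  refine Submodule.span_le.2 ?_
  rintro _ ⟨w, rfl, rfl⟩
  exact iterComm_mem_homog q _

theorem qd_of_mem_span_hatX {q : Fin N → Fin N → ℂ} {Q : Multiset (Fin N)} {i j : Fin N}
    (hij : i ≠ j) {x : FreeAlgebra ℂ (Fin N)} (hx : x ∈ Submodule.span ℂ (hatX q Q j)) :
    qd q i x = 0 := by
  have : Submodule.span ℂ (hatX q Q j) ≤ LinearMap.ker (qd q i) := by
    refine Submodule.span_le.2 ?_
    rintro _ ⟨w, -, rfl⟩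
    exact qd_iterComm hij w
  exact this hx

/-! ### Constants in smaller degrees -/

/-- Comparing coefficients at words ending in `k`: a word not starting with `k` has coefficient `0`,
and a leading `k` can be traded for a trailing one at the cost of the factor `a`. Every word in
`B_Q` contains `l ≠ k`, so its initial run of `k`s ends at another letter and finitely many trades
suffice. -/
theorem eq_zero_of_mul_ι_eq {Q : Multiset (Fin N)} {x : FreeAlgebra ℂ (Fin N)}
    (hx : x ∈ homog Q) {k l : Fin N} (hl : l ∈ Q) (hlk : l ≠ k) {a : ℂ}
    (h : x * ι ℂ k = a • (ι ℂ k * x)) : x = 0 := by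
  have main : ∀ (m : ℕ) (i : Fin N) (v : List (Fin N)), i ≠ k →
      coeffAt (List.replicate m k ++ i :: v) x = 0 := by
    intro m
    induction m with
    | zero =>
      intro i v hi
      have := congrArg (coeffAt (i :: v ++ [k])) h
      rw [coeffAt_concat_mul_ι, List.cons_append, map_smul, coeffAt_cons_ι_mul,
        if_neg hi.symm, smul_zero] at this
      simpa using this
    | succ m ih =>
      intro i v hi
      have := congrArg (coeffAt (k :: (List.replicate m k ++ i :: v) ++ [k])) h
      rw [coeffAt_concat_mul_ι, List.cons_append, map_smul, coeffAt_cons_ι_mul, if_pos rfl,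
        List.append_assoc, List.cons_append, ih i _ hi, smul_zero] at this
      simpa [List.replicate_succ] using this
  refine eq_zero_of_coeffAt fun u => ?_
  by_cases hu : (u : Multiset (Fin N)) = Q
  · have hlu : l ∈ u := by rw [← hu] at hl; exact hl
    have key : ∀ u : List (Fin N), l ∈ u →
        ∃ m i v, i ≠ k ∧ u = List.replicate m k ++ i :: v := by
      intro u
      induction u with
      | nil => simp
      | cons b u ih =>
        intro hb
        by_cases hbk : b = k
        · subst hbk
          obtain ⟨m, i, v, hi, rfl⟩ := ih ((List.mem_cons.1 hb).resolve_left hlk)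
          exact ⟨m + 1, i, v, hi, by simp [List.replicate_succ]⟩
        · exact ⟨0, b, u, hbk, rfl⟩
    obtain ⟨m, i, v, hi, rfl⟩ := key u hlu
    exact main m i v hi
  · exact coeffAt_eq_zero_of_mem_homog hx hu

/-- If a component one step up has no constant, neither has the given one. -/
theorem constantsIn_eq_bot_of_add_singleton {q : Fin N → Fin N → ℂ} {Q : Multiset (Fin N)}
    {k l : Fin N} (hl : l ∈ Q) (hlk : l ≠ k) (h : constantsIn q (Q + {k}) = ⊥) :
    constantsIn q Q = ⊥ := by
  refine (Submodule.eq_bot_iff _).2 fun x hx => ?_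
  have hQ : Q ≠ 0 := by rintro rfl; simp at hl
  obtain ⟨hxQ, hd⟩ := (mem_constantsIn_iff hQ).1 hx
  induction Q using Quotient.inductionOn with | _ w
  have hmem : qComm (commFactor q w k) x (ι ℂ k) ∈
      constantsIn q ((w : Multiset (Fin N)) + {k}) := by
    refine (mem_constantsIn_iff (by simp)).2 ⟨?_, fun i => qd_qComm_eq_zero hxQ (hd i) k⟩
    refine Submodule.sub_mem _ (mul_mem_homog hxQ (ι_mem_homog k)) (Submodule.smul_mem _ _ ?_)
    rw [add_comm]
    exact mul_mem_homog (ι_mem_homog k) hxQ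
  have h' : constantsIn q ((w : Multiset (Fin N)) + {k}) = ⊥ := h
  rw [h', Submodule.mem_bot, qComm, sub_eq_zero] at hmem
  exact eq_zero_of_mul_ι_eq hxQ hl hlk hmem

/-- `P` is joined to `Q` by adding letters one at a time, each step adding some `k` while a letter
other than `k` is already present; the chain ends at some `Q.erase k`. -/
theorem constantsIn_eq_bot_of_lt {q : Fin N → Fin N → ℂ} {Q : Multiset (Fin N)}
    (hstip : ∀ i ∈ Q, constantsIn q (Q.erase i) = ⊥)
    (hone : ∀ i : Fin N, (∀ l ∈ Q, l = i) → ∀ Q' < Q, constantsIn q Q' = ⊥)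
    {P : Multiset (Fin N)} (hP : P < Q) : constantsIn q P = ⊥ := by
  by_cases hs : ∃ i, ∀ l ∈ Q, l = i
  · obtain ⟨i, hi⟩ := hs
    exact hone i hi P hP
  push Not at hs
  clear hone
  obtain ⟨R, hR⟩ := Multiset.le_iff_exists_add.1 hP.le
  induction hn : R.card generalizing P R with
  | zero =>
    rw [Multiset.card_eq_zero] at hn
    simp [hR, hn] at hP
  | succ n ih =>
    rcases eq_or_ne P 0 with rfl | hP0
    · exact constantsIn_zero q
    have hR0 : R ≠ 0 := by rintro rfl; simp at hn
    -- Otherwise every letter of `R` equals every letter of `P`, and `Q` would consist of a single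
    -- index.
    obtain ⟨k, hk, l, hl, hlk⟩ : ∃ k ∈ R, ∃ l ∈ P, l ≠ k := by
      by_contra! hcon
      obtain ⟨l₀, hl₀⟩ := Multiset.exists_mem_of_ne_zero hP0
      obtain ⟨k₀, hk₀⟩ := Multiset.exists_mem_of_ne_zero hR0
      obtain ⟨l, hl, hne⟩ := hs k₀
      rw [hR] at hl
      rcases Multiset.mem_add.1 hl with hl | hl
      · exact hne (hcon k₀ hk₀ l hl)
      · exact hne ((hcon l hl l₀ hl₀).symm.trans (hcon k₀ hk₀ l₀ hl₀))
    obtain ⟨R, rfl⟩ := Multiset.exists_cons_of_mem hk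
    rcases eq_or_ne R 0 with rfl | hR'
    · have hPe : Q.erase k = P := by rw [hR, add_comm]; simp
      rw [← hPe]
      exact hstip k (by simp [hR])
    · have hQ : Q = P + {k} + R := by rw [hR, ← Multiset.singleton_add, add_assoc]
      refine constantsIn_eq_bot_of_add_singleton hl hlk (ih ?_ R hQ (by simpa using hn))
      rw [hQ]
      exact lt_add_of_pos_right _ (pos_iff_ne_zero.2 hR')

/-! ### The braided coproduct -/

/-- Right multiplication of a tensor by the coproduct `e_k ⊗ 1 + 1 ⊗ e_k` of a generator, in the
braided tensor square. -/
def copStep (q : Fin N → Fin N → ℂ) (k : Fin N) :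
    FreeAlgebra ℂ (Fin N) ⊗[ℂ] FreeAlgebra ℂ (Fin N) →ₗ[ℂ]
      FreeAlgebra ℂ (Fin N) ⊗[ℂ] FreeAlgebra ℂ (Fin N) :=
  TensorProduct.map LinearMap.id (LinearMap.mulRight ℂ (ι ℂ k)) +
    TensorProduct.map (LinearMap.mulRight ℂ (ι ℂ k)) (scale q k).toLinearMap

theorem copStep_tmul (q : Fin N → Fin N → ℂ) (k : Fin N) (x y : FreeAlgebra ℂ (Fin N)) :
    copStep q k (x ⊗ₜ y) = x ⊗ₜ (y * ι ℂ k) + (x * ι ℂ k) ⊗ₜ scale q k y := by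
  simp [copStep]

/-- The braided coproduct for which the generators are primitive. -/
def cop (q : Fin N → Fin N → ℂ) :
    FreeAlgebra ℂ (Fin N) →ₗ[ℂ] FreeAlgebra ℂ (Fin N) ⊗[ℂ] FreeAlgebra ℂ (Fin N) :=
  linearOfMon fun w => w.foldl (fun t k => copStep q k t) (1 ⊗ₜ 1)

theorem cop_one (q : Fin N → Fin N → ℂ) : cop q 1 = 1 ⊗ₜ 1 := by
  rw [← mon_nil, cop, linearOfMon_mon, List.foldl_nil, mon_nil]

theorem cop_mul_ι (q : Fin N → Fin N → ℂ) (x : FreeAlgebra ℂ (Fin N)) (k : Fin N) :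
    cop q (x * ι ℂ k) = copStep q k (cop q x) := by
  have : cop q ∘ₗ LinearMap.mulRight ℂ (ι ℂ k) = copStep q k ∘ₗ cop q :=
    linearMap_ext fun w => by
      simp [← mon_concat, cop, linearOfMon_mon]
  exact LinearMap.congr_fun this x

theorem map_scale_copStep (q : Fin N → Fin N → ℂ) (i k : Fin N)
    (t : FreeAlgebra ℂ (Fin N) ⊗[ℂ] FreeAlgebra ℂ (Fin N)) :
    TensorProduct.map (scale q i).toLinearMap (scale q i).toLinearMap (copStep q k t) =
      q i k • copStep q k (TensorProduct.map (scale q i).toLinearMap (scale q i).toLinearMap t) := by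
  have comm (y : FreeAlgebra ℂ (Fin N)) :
      scale q i (scale q k y) = scale q k (scale q i y) := by
    have : (scale q i).toLinearMap ∘ₗ (scale q k).toLinearMap =
        (scale q k).toLinearMap ∘ₗ (scale q i).toLinearMap :=
      linearMap_ext fun w => by simp [scale_mon, smul_comm (commFactor q w i)]
    exact LinearMap.congr_fun this y
  induction t using TensorProduct.induction_on with
  | zero => simp
  | add s t hs ht => simp only [map_add, hs, ht, smul_add]
  | tmul x y => simp [copStep_tmul, scale_ι, comm, smul_tmul']

theorem cop_scale (q : Fin N → Fin N → ℂ) (i : Fin N) (x : FreeAlgebra ℂ (Fin N)) :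
    cop q (scale q i x) =
      TensorProduct.map (scale q i).toLinearMap (scale q i).toLinearMap (cop q x) := by
  have : cop q ∘ₗ (scale q i).toLinearMap =
      TensorProduct.map (scale q i).toLinearMap (scale q i).toLinearMap ∘ₗ cop q := by
    refine linearMap_ext fun w => ?_
    induction w using List.reverseRecOn with
    | nil => simp [mon_nil, cop_one]
    | append_singleton w k ih =>
      simp only [LinearMap.comp_apply, AlgHom.toLinearMap_apply] at ih ⊢
      rw [mon_concat, cop_mul_ι, map_scale_copStep, ← ih, map_mul, scale_ι, mul_smul_comm,
        map_smul, cop_mul_ι]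
  exact LinearMap.congr_fun this x

/-- For `i = k` the Leibniz rule scales the left factor and the braiding scales the right one, by
the same automorphism; together they form the coproduct of a scaled element, by `cop_scale`. -/
theorem rTensor_qd_copStep (q : Fin N → Fin N → ℂ) (i k : Fin N)
    (t : FreeAlgebra ℂ (Fin N) ⊗[ℂ] FreeAlgebra ℂ (Fin N)) :
    (qd q i).rTensor _ (copStep q k t) = copStep q k ((qd q i).rTensor _ t) +
      if i = k then TensorProduct.map (scale q i).toLinearMap (scale q i).toLinearMap t else 0 := by
  induction t using TensorProduct.induction_on with
  | zero => simp
  | add s t hs ht =>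
    rw [map_add, map_add, hs, ht]
    split_ifs <;> simp only [map_add] <;> abel
  | tmul x y =>
    rw [copStep_tmul, map_add, LinearMap.rTensor_tmul, LinearMap.rTensor_tmul,
      LinearMap.rTensor_tmul, copStep_tmul, qd_mul_ι]
    split_ifs with h
    · subst h; simp [add_tmul, add_assoc]
    · simp

/-- Coassociativity in its first order part. -/
theorem rTensor_qd_cop (q : Fin N → Fin N → ℂ) (i : Fin N) (x : FreeAlgebra ℂ (Fin N)) :
    (qd q i).rTensor _ (cop q x) = cop q (qd q i x) := by
  have : (qd q i).rTensor _ ∘ₗ cop q = cop q ∘ₗ qd q i := by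
    refine linearMap_ext fun w => ?_
    induction w using List.reverseRecOn with
    | nil => simp [mon_nil, cop_one, qd_one]
    | append_singleton w k ih =>
      simp only [LinearMap.comp_apply] at ih ⊢
      rw [mon_concat, cop_mul_ι, rTensor_qd_copStep, ih, qd_mul_ι, map_add, cop_mul_ι]
      split_ifs <;> simp [cop_scale]
  exact LinearMap.congr_fun this x

/-- The tensors of total degree `Q`. -/
def homogTensor (Q : Multiset (Fin N)) :
    Submodule ℂ (FreeAlgebra ℂ (Fin N) ⊗[ℂ] FreeAlgebra ℂ (Fin N)) :=
  Submodule.span ℂ {t | ∃ v w : List (Fin N), ((v ++ w : List (Fin N)) : Multiset (Fin N)) = Q ∧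
    t = mon v ⊗ₜ mon w}

theorem copStep_mem_homogTensor (q : Fin N → Fin N → ℂ) {Q : Multiset (Fin N)} (k : Fin N)
    {t : FreeAlgebra ℂ (Fin N) ⊗[ℂ] FreeAlgebra ℂ (Fin N)} (ht : t ∈ homogTensor Q) :
    copStep q k t ∈ homogTensor (Q + {k}) := by
  have : homogTensor Q ≤ (homogTensor (Q + {k})).comap (copStep q k) := by
    refine Submodule.span_le.2 ?_
    rintro _ ⟨v, w, rfl, rfl⟩
    rw [SetLike.mem_coe, Submodule.mem_comap, copStep_tmul, scale_mon, tmul_smul, ← mon_concat,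
      ← mon_concat]
    refine Submodule.add_mem _ (Submodule.subset_span ⟨_, _, ?_, rfl⟩)
      (Submodule.smul_mem _ _ (Submodule.subset_span ⟨_, _, ?_, rfl⟩))
    · simp [← Multiset.coe_add, ← add_assoc, ← Multiset.coe_singleton]
    · simp only [← Multiset.coe_add, ← Multiset.coe_singleton]
      abel
  exact this ht

theorem cop_mem_homogTensor (q : Fin N → Fin N → ℂ) {Q : Multiset (Fin N)}
    {x : FreeAlgebra ℂ (Fin N)} (hx : x ∈ homog Q) : cop q x ∈ homogTensor Q := by
  have : homog Q ≤ (homogTensor Q).comap (cop q) := by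
    refine Submodule.span_le.2 ?_
    rintro _ ⟨w, rfl, rfl⟩
    rw [SetLike.mem_coe, Submodule.mem_comap]
    clear hx
    induction w using List.reverseRecOn with
    | nil =>
      exact Submodule.subset_span ⟨[], [], rfl, by rw [mon_nil, cop_one]⟩
    | append_singleton w k ih =>
      rw [mon_concat, cop_mul_ι, ← Multiset.coe_add]
      exact copStep_mem_homogTensor q k ih
  exact this hx

/-- The coefficient of `mon u` in the second tensor factor. -/
def coeffRight (u : List (Fin N)) :
    FreeAlgebra ℂ (Fin N) ⊗[ℂ] FreeAlgebra ℂ (Fin N) →ₗ[ℂ] FreeAlgebra ℂ (Fin N) :=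
  (TensorProduct.rid ℂ _).toLinearMap ∘ₗ (coeffAt u).lTensor _

theorem coeffRight_tmul (u : List (Fin N)) (x y : FreeAlgebra ℂ (Fin N)) :
    coeffRight u (x ⊗ₜ y) = coeffAt u y • x := by
  simp [coeffRight]

theorem coeffRight_rTensor (u : List (Fin N))
    (g : FreeAlgebra ℂ (Fin N) →ₗ[ℂ] FreeAlgebra ℂ (Fin N))
    (t : FreeAlgebra ℂ (Fin N) ⊗[ℂ] FreeAlgebra ℂ (Fin N)) :
    coeffRight u (g.rTensor _ t) = g (coeffRight u t) := by
  induction t using TensorProduct.induction_on with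
  | zero => simp
  | add s t hs ht => simp only [map_add, hs, ht]
  | tmul x y => simp [coeffRight_tmul]

/-- Stating the degree through `v ++ u` avoids multiset subtraction; the span is zero when `u` does
not fit into `Q`. -/
theorem coeffRight_mem {Q : Multiset (Fin N)}
    {t : FreeAlgebra ℂ (Fin N) ⊗[ℂ] FreeAlgebra ℂ (Fin N)} (ht : t ∈ homogTensor Q)
    (u : List (Fin N)) : coeffRight u t ∈
      Submodule.span ℂ {x | ∃ v : List (Fin N), ((v ++ u : List (Fin N)) : Multiset (Fin N)) = Q ∧
        x = mon v} := by
  have : homogTensor Q ≤ (Submodule.span ℂ {x | ∃ v : List (Fin N),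
      ((v ++ u : List (Fin N)) : Multiset (Fin N)) = Q ∧ x = mon v}).comap (coeffRight u) := by
    refine Submodule.span_le.2 ?_
    rintro _ ⟨v, w, hvw, rfl⟩
    rw [SetLike.mem_coe, Submodule.mem_comap, coeffRight_tmul, coeffAt_mon]
    split_ifs with h
    · subst h
      rw [one_smul]
      exact Submodule.subset_span ⟨v, hvw, rfl⟩
    · rw [zero_smul]
      exact Submodule.zero_mem _
  exact this ht

theorem exists_sum_coeffRight (t : FreeAlgebra ℂ (Fin N) ⊗[ℂ] FreeAlgebra ℂ (Fin N)) :
    ∃ s : Finset (List (Fin N)), t = ∑ u ∈ s, coeffRight u t ⊗ₜ mon u := by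
  obtain ⟨b, hb⟩ := TensorProduct.eq_repr_basis_right (basisFreeMonoid ℂ (Fin N)) t
  have hcoeff (u : FreeMonoid (Fin N)) : coeffRight u.toList t = b u := by
    rw [← hb, Finsupp.sum, map_sum]
    simp only [coeffRight_tmul, basis_apply, coeffAt_mon, ite_smul, one_smul, zero_smul]
    rw [Finset.sum_eq_single u (fun v _ hv => if_neg fun e => hv (FreeMonoid.toList.injective e))
      fun h => by rw [if_pos rfl, Finsupp.notMem_support_iff.1 h], if_pos rfl]
  refine ⟨b.support.map FreeMonoid.toList.toEmbedding, ?_⟩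
  rw [Finset.sum_map]
  conv_lhs => rw [← hb, Finsupp.sum]
  exact Finset.sum_congr rfl fun u _ => by rw [← hcoeff, basis_apply]; rfl

/-! ### The Dynkin operator -/

/-- The map `x ⊗ y ↦ x * g y`. -/
def mulTensor (g : FreeAlgebra ℂ (Fin N) →ₗ[ℂ] FreeAlgebra ℂ (Fin N)) :
    FreeAlgebra ℂ (Fin N) ⊗[ℂ] FreeAlgebra ℂ (Fin N) →ₗ[ℂ] FreeAlgebra ℂ (Fin N) :=
  LinearMap.mul' ℂ _ ∘ₗ g.lTensor _

theorem mulTensor_tmul (g : FreeAlgebra ℂ (Fin N) →ₗ[ℂ] FreeAlgebra ℂ (Fin N))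
    (x y : FreeAlgebra ℂ (Fin N)) : mulTensor g (x ⊗ₜ y) = x * g y := by
  simp [mulTensor]

theorem coeffRight_nil_copStep (q : Fin N → Fin N → ℂ) (k : Fin N)
    (t : FreeAlgebra ℂ (Fin N) ⊗[ℂ] FreeAlgebra ℂ (Fin N)) :
    coeffRight [] (copStep q k t) = coeffRight [] t * ι ℂ k := by
  have h1 (y : FreeAlgebra ℂ (Fin N)) : coeffAt [] (y * ι ℂ k) = 0 := by
    have : coeffAt [] ∘ₗ LinearMap.mulRight ℂ (ι ℂ k) = 0 :=
      linearMap_ext fun w => by simp [← mon_concat, coeffAt_mon]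
    exact LinearMap.congr_fun this y
  have h2 (y : FreeAlgebra ℂ (Fin N)) : coeffAt [] (scale q k y) = coeffAt [] y := by
    have : coeffAt [] ∘ₗ (scale q k).toLinearMap = coeffAt [] :=
      linearMap_ext fun w => by
        rcases eq_or_ne w [] with rfl | hw
        · simp [mon_nil]
        · simp [scale_mon, coeffAt_mon, hw]
    exact LinearMap.congr_fun this y
  induction t using TensorProduct.induction_on with
  | zero => simp
  | add s t hs ht => simp only [map_add, hs, ht, add_mul]
  | tmul x y => simp [copStep_tmul, coeffRight_tmul, h1, h2]

theorem coeffRight_nil_cop (q : Fin N → Fin N → ℂ) (w : List (Fin N)) :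
    coeffRight [] (cop q (mon w)) = mon w := by
  induction w using List.reverseRecOn with
  | nil => rw [mon_nil, cop_one, coeffRight_tmul, ← mon_nil, coeffAt_mon, if_pos rfl, one_smul]
  | append_singleton w k ih => rw [mon_concat, cop_mul_ι, coeffRight_nil_copStep, ih]

/-- The Dynkin operator: `mon (j :: w)` is sent to the iterated commutator `X^{j w}`, and the
monomials that do not start with `e_j` are sent to `0`. -/
def dynkin (q : Fin N → Fin N → ℂ) (j : Fin N) :
    FreeAlgebra ℂ (Fin N) →ₗ[ℂ] FreeAlgebra ℂ (Fin N) :=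
  linearOfMon fun w => if w.head? = some j then iterComm q w else 0

theorem dynkin_mon (q : Fin N → Fin N → ℂ) (j : Fin N) (w : List (Fin N)) :
    dynkin q j (mon w) = if w.head? = some j then iterComm q w else 0 :=
  linearOfMon_mon _ _

theorem dynkin_mon_mem_homog (q : Fin N → Fin N → ℂ) (j : Fin N) (w : List (Fin N)) :
    dynkin q j (mon w) ∈ homog (w : Multiset (Fin N)) := by
  rw [dynkin_mon]
  split_ifs
  · exact iterComm_mem_homog q w
  · exact Submodule.zero_mem _

theorem dynkin_mon_mem_span (q : Fin N → Fin N → ℂ) (j : Fin N) (w : List (Fin N)) :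
    dynkin q j (mon w) ∈ Submodule.span ℂ (hatX q (w : Multiset (Fin N)) j) := by
  rw [dynkin_mon]
  split_ifs with h
  · obtain ⟨v, rfl⟩ := List.head?_eq_some_iff.1 h
    exact Submodule.subset_span ⟨v, rfl, rfl⟩
  · exact Submodule.zero_mem _

theorem dynkin_scale (q : Fin N → Fin N → ℂ) (i j : Fin N) (x : FreeAlgebra ℂ (Fin N)) :
    dynkin q j (scale q i x) = scale q i (dynkin q j x) := by
  have : dynkin q j ∘ₗ (scale q i).toLinearMap = (scale q i).toLinearMap ∘ₗ dynkin q j :=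
    linearMap_ext fun w => by
      simp [scale_mon, scale_of_mem_homog q i (dynkin_mon_mem_homog q j w)]
  exact LinearMap.congr_fun this x

/-- The last term corrects the commutator recursion at the empty word: `1` goes to `0`, yet `e_j`
goes to `e_j`. -/
theorem dynkin_mul_ι (q : Fin N → Fin N → ℂ) (j k : Fin N) (x : FreeAlgebra ℂ (Fin N)) :
    dynkin q j (x * ι ℂ k) = dynkin q j x * ι ℂ k - ι ℂ k * scale q k (dynkin q j x) +
      if k = j then coeffAt [] x • ι ℂ k else 0 := by
  have : dynkin q j ∘ₗ LinearMap.mulRight ℂ (ι ℂ k) =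
      LinearMap.mulRight ℂ (ι ℂ k) ∘ₗ dynkin q j -
        LinearMap.mulLeft ℂ (ι ℂ k) ∘ₗ (scale q k).toLinearMap ∘ₗ dynkin q j +
      if k = j then (coeffAt []).smulRight (ι ℂ k) else 0 := by
    refine linearMap_ext fun w => ?_
    rcases eq_or_ne w [] with rfl | hw
    · have : dynkin q j (mon [k]) = if k = j then ι ℂ k else 0 := by
        rw [dynkin_mon, iterComm_singleton]; simp
      have h0 : dynkin q j (mon []) = 0 := by rw [dynkin_mon]; simp
      have h1 : mon [k] = ι ℂ k := by simp [mon]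
      rw [h1] at this
      split_ifs at this ⊢ with h <;> simp [h0, coeffAt_mon] <;> simpa [mon_nil] using this
    · have hz : coeffAt [] (mon w) = 0 := by simp [coeffAt_mon, hw]
      have hh : (w ++ [k]).head? = w.head? := by
        cases w with
        | nil => exact absurd rfl hw
        | cons => rfl
      have key : dynkin q j (mon w * ι ℂ k) = dynkin q j (mon w) * ι ℂ k -
          ι ℂ k * scale q k (dynkin q j (mon w)) := by
        rw [scale_of_mem_homog q k (dynkin_mon_mem_homog q j w), ← mon_concat, dynkin_mon,
          dynkin_mon, hh]
        split_ifs
        · rw [iterComm_append q w hw, qComm, mul_smul_comm]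
        · simp
      split_ifs <;> simp [key, hz]
  have := LinearMap.congr_fun this x
  split_ifs at this ⊢ <;> simpa using this

/-- On `x ⊗ y`, the subtracted half of the commutator in `dynkin q j (y * ι ℂ k)` cancels the term
in which `e_k` was braided past `y`. Only the correction for constant `y` survives, and it counts an
occurrence of `j`. -/
theorem mulTensor_dynkin_copStep (q : Fin N → Fin N → ℂ) (j k : Fin N)
    (t : FreeAlgebra ℂ (Fin N) ⊗[ℂ] FreeAlgebra ℂ (Fin N)) :
    mulTensor (dynkin q j) (copStep q k t) = mulTensor (dynkin q j) t * ι ℂ k +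
      if k = j then coeffRight [] t * ι ℂ k else 0 := by
  induction t using TensorProduct.induction_on with
  | zero => simp
  | add s t hs ht =>
    rw [map_add, map_add, hs, ht]
    split_ifs <;> simp only [map_add, add_mul] <;> abel
  | tmul x y =>
    rw [copStep_tmul, map_add, mulTensor_tmul, mulTensor_tmul, mulTensor_tmul, coeffRight_tmul,
      dynkin_mul_ι, dynkin_scale]
    split_ifs <;>
      simp only [mul_add, mul_sub, mul_assoc, mul_smul_comm, smul_mul_assoc, add_zero] <;> abel

/-- The Dynkin operator is the convolution inverse of the identity times the derivation counting
the letter `j`. -/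
theorem mulTensor_dynkin_cop (q : Fin N → Fin N → ℂ) {j : Fin N} {Q : Multiset (Fin N)}
    {x : FreeAlgebra ℂ (Fin N)} (hx : x ∈ homog Q) :
    mulTensor (dynkin q j) (cop q x) = (Q.count j : ℂ) • x := by
  have : homog Q ≤ LinearMap.eqLocus (mulTensor (dynkin q j) ∘ₗ cop q)
      ((Q.count j : ℂ) • LinearMap.id) := by
    refine Submodule.span_le.2 ?_
    rintro _ ⟨w, rfl, rfl⟩
    simp only [SetLike.mem_coe, LinearMap.mem_eqLocus, LinearMap.comp_apply, LinearMap.smul_apply,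
      LinearMap.id_apply, Multiset.coe_count]
    clear hx
    induction w using List.reverseRecOn with
    | nil =>
      rw [mon_nil, cop_one, mulTensor_tmul, ← mon_nil, dynkin_mon]
      simp
    | append_singleton w k ih =>
      rw [mon_concat, cop_mul_ι, mulTensor_dynkin_copStep, ih, coeffRight_nil_cop, List.count_append]
      split_ifs with h
      · subst h; simp [add_smul]
      · simp [h]
  exact this hx

theorem constantsIn_le_span_hatX {q : Fin N → Fin N → ℂ} {Q : Multiset (Fin N)}
    (h : ∀ P < Q, constantsIn q P = ⊥) {j : Fin N} (hj : j ∈ Q) :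
    constantsIn q Q ≤ Submodule.span ℂ (hatX q Q j) := by
  intro x hx
  have hQ : Q ≠ 0 := by rintro rfl; simp at hj
  obtain ⟨hxQ, hd⟩ := (mem_constantsIn_iff hQ).1 hx
  -- Characteristic `0` enters here: the multiplicity of `j` must be invertible.
  have hcount : (Q.count j : ℂ) ≠ 0 := by
    exact_mod_cast (Multiset.count_pos.2 hj).ne'
  suffices H : (Q.count j : ℂ) • x ∈ Submodule.span ℂ (hatX q Q j) by
    simpa [smul_smul, hcount] using Submodule.smul_mem _ ((Q.count j : ℂ)⁻¹) H
  rw [← mulTensor_dynkin_cop q hxQ]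
  obtain ⟨s, hs⟩ := exists_sum_coeffRight (cop q x)
  rw [hs, map_sum]
  refine Submodule.sum_mem _ fun u _ => ?_
  rw [mulTensor_tmul]
  have hmem := coeffRight_mem (cop_mem_homogTensor q hxQ) u
  have hker (i : Fin N) : qd q i (coeffRight u (cop q x)) = 0 := by
    rw [← coeffRight_rTensor, rTensor_qd_cop, hd, map_zero, map_zero]
  generalize coeffRight u (cop q x) = y at hmem hker
  by_cases huQ : (u : Multiset (Fin N)) ≤ Q
  swap
  · have hset : {x | ∃ v : List (Fin N), ((v ++ u : List (Fin N)) : Multiset (Fin N)) = Q ∧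
        x = mon v} = ∅ := by
      refine Set.eq_empty_of_forall_notMem ?_
      rintro _ ⟨v, rfl, -⟩
      exact huQ (by rw [← Multiset.coe_add]; exact Multiset.le_add_left _ _)
    rw [hset, Submodule.span_empty, Submodule.mem_bot] at hmem
    rw [hmem, zero_mul]
    exact Submodule.zero_mem _
  obtain ⟨P, rfl⟩ := Multiset.le_iff_exists_add.1 huQ
  have hyP : y ∈ homog P := by
    refine Submodule.span_mono ?_ hmem
    rintro _ ⟨v, hv, rfl⟩
    rw [← Multiset.coe_add, add_comm] at hv
    exact ⟨v, add_left_cancel hv, rfl⟩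
  -- `P` is the degree of the left coefficient `y`. If `P = 0`, then `u` has full degree `Q` and
  -- `dynkin` gives an element of the span.
  rcases eq_or_ne P 0 with rfl | hP
  · obtain ⟨c, rfl⟩ := mem_homog_zero hyP
    rw [smul_mul_assoc, one_mul, add_zero]
    exact Submodule.smul_mem _ _ (dynkin_mon_mem_span q j u)
  -- The term `x ⊗ 1` drops out because the empty word has no first letter; all other terms have `y`
  -- a constant of degree strictly below `Q`.
  rcases eq_or_ne u [] with rfl | hu
  · rw [dynkin_mon]
    simp
  · have hlt : P < (u : Multiset (Fin N)) + P :=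
      lt_add_of_pos_left _ (pos_iff_ne_zero.2 (by simpa using hu))
    have hy : y ∈ constantsIn q P := (mem_constantsIn_iff hP).2 ⟨hyP, hker⟩
    rw [h P hlt, Submodule.mem_bot] at hy
    rw [hy, zero_mul]
    exact Submodule.zero_mem _

end

end QAlg

theorem theorem3p2p4 {N : ℕ} (q : Fin N → Fin N → ℂ) (hq : ∀ i j, q i j ≠ 0)
    (Q : Multiset (Fin N))
    (hstip : ∀ i ∈ Q, QAlg.constantsIn q (Q.erase i) = ⊥)
    (hone : ∀ i : Fin N, (∀ l ∈ Q, l = i) → ∀ Q' < Q, QAlg.constantsIn q Q' = ⊥) :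
    (∀ j ∈ Q, QAlg.constantsIn q Q ≤ Submodule.span ℂ (QAlg.hatX q Q j)) ∧
    (∀ i ∈ Q, ∀ j ∈ Q, i ≠ j →
      QAlg.constantsIn q Q =
        Submodule.span ℂ (QAlg.hatX q Q i) ⊓ Submodule.span ℂ (QAlg.hatX q Q j)) := by
  have main : ∀ j ∈ Q, QAlg.constantsIn q Q ≤ Submodule.span ℂ (QAlg.hatX q Q j) := fun j hj =>
    QAlg.constantsIn_le_span_hatX
      (fun P hP => QAlg.constantsIn_eq_bot_of_lt hstip hone hP) hj
  refine ⟨main, fun i hi j hj hij => le_antisymm (le_inf (main i hi) (main j hj)) ?_⟩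
  rintro x ⟨hxi, hxj⟩
  have hQ : Q ≠ 0 := by rintro rfl; simp at hi
  refine (QAlg.mem_constantsIn_iff hQ).2 ⟨QAlg.span_hatX_le_homog q Q i hxi, fun k => ?_⟩
  -- Each span controls every `∂_k` but one; since `i ≠ j`, the exceptional indices differ.
  by_cases hki : k = i
  · exact QAlg.qd_of_mem_span_hatX (hki ▸ hij) hxj
  · exact QAlg.qd_of_mem_span_hatX hki hxi
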